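/- Let $\mathcal{L}$ be the propositional language with variables $p_0,p_1,\dots$, the Boolean connectives $\wedge,\neg$ (and the derived ones), and two unary modal operators $\Box$ and $\forall$, where $\exists=\neg\forall\neg$. A \emph{normal modal logic with the universal modality} is a set $L$ of $\mathcal{L}$-formulas that contains all propositional tautologies and the axioms $$\Box(p\to q)\to(\Box p\to\Box q),\quad \forall(p\to q)\to(\forall p\to\forall q),\quad \forall p\to p,\quad \forall p\to\forall\forall p,\quad p\to\forall\exists p,\quad \forall p\to\Box p,$$ and is closed under modus ponens, the necessitation rules $\varphi/\Box\varphi$ and $\varphi/\forall\varphi$, and uniform substitution. Let $\mathsf{K}_u$ be the smallest such logic, and $\mathsf{K4}_u$ the smallest such logic that contains $\Box p\to\Box\Box p$. An inference rule $\varphi_1,\dots,\varphi_n/\varphi$ is \emph{admissible} in $L$ if, for every substitution $\sigma$, $\sigma(\varphi_1)\in L,\dots,\sigma(\varphi_n)\in L$ imply $\sigma(\varphi)\in L$. \textbf{Theorem.} For every normal modal logic $L$ with the universal modality such that $\mathsf{K}_u\subseteq L\subseteq\mathsf{K4}_u$, the admissibility problem for $L$ is undecidable: there is no algorithm that decides,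 given an inference rule $\varphi_1,\dots,\varphi_n/\varphi$, whether it is admissible in $L$. -/

import Mathlib

/-! ## Propositional modal logics with the universal modality -/

namespace ModalU

/-- Formulas of the propositional language with variables `p₀, p₁, …`, the Boolean connectives
`∧` and `¬`, and two unary modal operators: `□` (`box`) and the universal modality `∀`
(`univ`). -/
inductive Formula : Type
  | var (n : ℕ) : Formula
  | neg (φ : Formula) : Formula
  | and (φ ψ : Formula) : Formula
  | box (φ : Formula) : Formula
  | univ (φ : Formula) : Formula

namespace Formula

/-- `φ → ψ`, as `¬(φ ∧ ¬ψ)`. -/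
def imp (φ ψ : Formula) : Formula := neg (and φ (neg ψ))

/-- The dual `∃` of the universal modality: `∃φ = ¬∀¬φ`. -/
def ex (φ : Formula) : Formula := neg (univ (neg φ))

/-- The formula `σ(φ)`: uniform substitution of the formula `σ n` for each variable `pₙ`. -/
def subst (σ : ℕ → Formula) : Formula → Formula
  | var n => σ n
  | neg φ => neg (subst σ φ)
  | and φ ψ => and (subst σ φ) (subst σ ψ)
  | box φ => box (subst σ φ)
  | univ φ => univ (subst σ φ)

/-- Boolean evaluation: `v` assigns arbitrary truth values to variables and to formulas starting
with a modal operator, and `¬` and `∧` are interpreted classically. -/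
def boolEval (v : Formula → Bool) : Formula → Bool
  | var n => v (var n)
  | neg φ => !(boolEval v φ)
  | and φ ψ => boolEval v φ && boolEval v ψ
  | box φ => v (box φ)
  | univ φ => v (univ φ)

/-- `φ` is a propositional tautology (in the modal language). -/
def IsTautology (φ : Formula) : Prop := ∀ v : Formula → Bool, boolEval v φ = true

/-! ### Gödel numbering -/

/-- The Gödel number of a formula. -/
def toNat : Formula → ℕ
  | var n => 5 * n
  | neg φ => 5 * toNat φ + 1
  | and φ ψ => 5 * Nat.pair (toNat φ) (toNat ψ) + 2
  | box φ => 5 * toNat φ + 3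
  | univ φ => 5 * toNat φ + 4

theorem exists_toNat_eq (n : ℕ) : ∃ φ : Formula, toNat φ = n := by
  induction n using Nat.strong_induction_on with
  | _ n ih =>
    have hn : n = 5 * (n / 5) + n % 5 := (Nat.div_add_mod n 5).symm
    have hlt : n % 5 < 5 := Nat.mod_lt _ (by norm_num)
    generalize n / 5 = m at hn
    generalize n % 5 = r at hn hlt
    subst hn
    interval_cases r
    · exact ⟨var m, rfl⟩
    · obtain ⟨φ, hφ⟩ := ih m (by omega)
      exact ⟨neg φ, by simp [toNat, hφ]⟩
    · obtain ⟨φ, hφ⟩ := ih m.unpair.1 (by have := Nat.unpair_left_le m; omega)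
      obtain ⟨ψ, hψ⟩ := ih m.unpair.2 (by have := Nat.unpair_right_le m; omega)
      exact ⟨and φ ψ, by simp [toNat, hφ, hψ]⟩
    · obtain ⟨φ, hφ⟩ := ih m (by omega)
      exact ⟨box φ, by simp [toNat, hφ]⟩
    · obtain ⟨φ, hφ⟩ := ih m (by omega)
      exact ⟨univ φ, by simp [toNat, hφ]⟩

theorem toNat_injective : Function.Injective toNat := by
  intro φ
  induction φ with
  | var n => intro ψ h; cases ψ <;> simp only [toNat] at h <;> first | omega | (congr 1; omega)
  | neg φ ih =>
    intro ψ h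
    cases ψ <;> simp only [toNat] at h <;> first | omega | exact congrArg neg (ih (by omega))
  | and φ χ ih₁ ih₂ =>
    intro ψ h
    cases ψ with
    | and φ' χ' =>
      simp only [toNat] at h
      obtain ⟨h₁, h₂⟩ := Nat.pair_eq_pair.1 (show Nat.pair φ.toNat χ.toNat =
        Nat.pair φ'.toNat χ'.toNat by omega)
      rw [ih₁ h₁, ih₂ h₂]
    | _ => simp only [toNat] at h; omega
  | box φ ih =>
    intro ψ h
    cases ψ <;> simp only [toNat] at h <;> first | omega | exact congrArg box (ih (by omega))
  | univ φ ih =>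
    intro ψ h
    cases ψ <;> simp only [toNat] at h <;> first | omega | exact congrArg univ (ih (by omega))

/-- The Gödel numbering as a bijection between formulas and natural numbers. -/
noncomputable def equivNat : Formula ≃ ℕ :=
  Equiv.ofBijective toNat ⟨toNat_injective, exists_toNat_eq⟩

/-- Computability of predicates on formulas is understood via the Gödel numbering. -/
noncomputable instance : Primcodable Formula := Primcodable.ofEquiv ℕ equivNat

theorem encode_eq_toNat (φ : Formula) : Encodable.encode φ = toNat φ := rfl

end Formula

open Formula

/-- `L` is a normal modal logic with the universal modality. -/
structure IsNormalLogic (L : Set Formula) : Prop where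
  taut : ∀ φ : Formula, φ.IsTautology → φ ∈ L
  /-- `□(p → q) → (□p → □q)` -/
  box_K : imp (box (imp (var 0) (var 1))) (imp (box (var 0)) (box (var 1))) ∈ L
  /-- `∀(p → q) → (∀p → ∀q)` -/
  univ_K : imp (univ (imp (var 0) (var 1))) (imp (univ (var 0)) (univ (var 1))) ∈ L
  /-- `∀p → p` -/
  univ_T : imp (univ (var 0)) (var 0) ∈ L
  /-- `∀p → ∀∀p` -/
  univ_4 : imp (univ (var 0)) (univ (univ (var 0))) ∈ L
  /-- `p → ∀∃p` -/
  univ_B : imp (var 0) (univ (ex (var 0))) ∈ L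
  /-- `∀p → □p` -/
  univ_box : imp (univ (var 0)) (box (var 0)) ∈ L
  mp : ∀ φ ψ : Formula, imp φ ψ ∈ L → φ ∈ L → ψ ∈ L
  nec_box : ∀ φ : Formula, φ ∈ L → box φ ∈ L
  nec_univ : ∀ φ : Formula, φ ∈ L → univ φ ∈ L
  subst : ∀ (σ : ℕ → Formula) (φ : Formula), φ ∈ L → φ.subst σ ∈ L

/-- `K_u`, the smallest normal modal logic with the universal modality. -/
def Ku : Set Formula := ⋂₀ {L | IsNormalLogic L}

/-- `K4_u`, the smallest normal modal logic with the universal modality that contains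
`□p → □□p`. -/
def K4u : Set Formula :=
  ⋂₀ {L | IsNormalLogic L ∧ imp (box (var 0)) (box (box (var 0))) ∈ L}

/-- An inference rule `φ₁, …, φₙ / φ`: a finite list of premises and a conclusion. -/
abbrev InferenceRule : Type := List Formula × Formula

/-- The rule `φ₁, …, φₙ / φ` is admissible in `L`: for every substitution `σ`, if
`σ(φ₁), …, σ(φₙ)` all belong to `L`, then so does `σ(φ)`. -/
def Admissible (L : Set Formula) (r : InferenceRule) : Prop :=
  ∀ σ : ℕ → Formula, (∀ φ ∈ r.1, φ.subst σ ∈ L) → r.2.subst σ ∈ L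

end ModalU

/-! The halting problem reduces to unifiability: since `L` is consistent, the rule φ/⊥ is admissible
exactly when no substitution instance of φ lies in `L`. Evaluation of codes of partial recursive
functions is axiomatised by a fixed list of Horn clauses over ℕ, so that a code halts on input 0 iff
one ground atom is derivable (`derivable_halt_iff`). Numbers, variables and atoms are then described
by modal formulas. A variable denotes the `R`-minimal number satisfying a propositional variable,
and an atom says that somewhere there is a point coding a quadruple. The goal formula says: if all
clauses hold, then so does the ground atom.

Derivable goals are unifiable (`exists_subst_mem_of_derivable`). A derivation uses finitely many
ground instances of clauses. The unifier makes the propositional variables denote the numbers of the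
first instance that fails in the given model. That clause is then false and the implication holds.
If no instance fails, the derivation shows that the goal is true. Atoms begin with ∃, so the case
distinction is the same at all points of a model, and it can be written as a Boolean combination.
The resulting formula is valid in every Kripke model, hence in `L` by the canonical model
construction.

Unifiable goals are derivable (`derivable_of_subst_mem`). A transitive frame is built whose
quadruple points are exactly the derivable atoms. Whatever the valuation, a propositional variable
true at some number has a least such number, and one true at no number falsifies every atom in which
it occurs. Because each variable of a conclusion occurs in a premise, all clauses hold under every
valuation. A unifier therefore forces the goal to be true in the frame, that is, derivable. The
frame is transitive, so this applies to every `L` below `K4u`. -/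

namespace ModalU

open Formula

/-! ## Kripke semantics -/

/-- Truth of a formula at a point of a Kripke model, `∀` being the universal modality. -/
def Sat {W : Type} (R : W → W → Prop) (V : ℕ → W → Prop) : Formula → W → Prop
  | var n, x => V n x
  | neg φ, x => ¬ Sat R V φ x
  | Formula.and φ ψ, x => Sat R V φ x ∧ Sat R V ψ x
  | box φ, x => ∀ y, R x y → Sat R V φ y
  | univ φ, _ => ∀ y, Sat R V φ y

section Semantics

variable {W : Type} {R : W → W → Prop} {V : ℕ → W → Prop}

@[simp] theorem sat_var (n : ℕ) (x : W) : Sat R V (var n) x ↔ V n x := Iff.rfl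

@[simp] theorem sat_neg (φ : Formula) (x : W) : Sat R V (neg φ) x ↔ ¬ Sat R V φ x := Iff.rfl

@[simp] theorem sat_and (φ ψ : Formula) (x : W) :
    Sat R V (Formula.and φ ψ) x ↔ Sat R V φ x ∧ Sat R V ψ x := Iff.rfl

@[simp] theorem sat_box (φ : Formula) (x : W) :
    Sat R V (box φ) x ↔ ∀ y, R x y → Sat R V φ y := Iff.rfl

@[simp] theorem sat_univ (φ : Formula) (x : W) : Sat R V (univ φ) x ↔ ∀ y, Sat R V φ y := Iff.rfl

@[simp] theorem sat_imp (φ ψ : Formula) (x : W) :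
    Sat R V (imp φ ψ) x ↔ (Sat R V φ x → Sat R V ψ x) := by
  simp [imp]

@[simp] theorem sat_ex (φ : Formula) (x : W) : Sat R V (ex φ) x ↔ ∃ y, Sat R V φ y := by
  simp [ex]

theorem sat_subst (σ : ℕ → Formula) (φ : Formula) (x : W) :
    Sat R V (φ.subst σ) x ↔ Sat R (fun n y => Sat R V (σ n) y) φ x := by
  induction φ generalizing x with
  | var n => rfl
  | neg φ ih => simp [Formula.subst, ih]
  | and φ ψ ih₁ ih₂ => simp [Formula.subst, ih₁, ih₂]
  | box φ ih => simp [Formula.subst, ih]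
  | univ φ ih => simp [Formula.subst, ih]

-- Truth at a fixed point is a Boolean valuation that treats modal formulas as atoms; hence
-- tautologies hold at every point.
open Classical in
theorem boolEval_decide_sat (φ : Formula) (x : W) :
    boolEval (fun ψ => decide (Sat R V ψ x)) φ = decide (Sat R V φ x) := by
  induction φ with
  | neg φ ih => simp [boolEval, ih]
  | and φ ψ ih₁ ih₂ => simp [boolEval, ih₁, ih₂]
  | _ => rfl

theorem IsTautology.sat {φ : Formula} (h : φ.IsTautology) (x : W) : Sat R V φ x := by
  classical
  have := h fun ψ => decide (Sat R V ψ x)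
  rw [boolEval_decide_sat] at this
  simpa using this

end Semantics

/-- The formulas valid in a Kripke frame form a normal logic with the universal modality. -/
theorem isNormalLogic_valid {W : Type} (R : W → W → Prop) :
    IsNormalLogic {φ | ∀ V x, Sat R V φ x} where
  taut _ h _ x := IsTautology.sat h x
  box_K V x := by
    simp only [sat_imp, sat_box]
    exact fun h h' y hy => h y hy (h' y hy)
  univ_K V x := by
    simp only [sat_imp, sat_univ]
    exact fun h h' y => h y (h' y)
  univ_T V x := by
    simp only [sat_imp, sat_univ]
    exact fun h => h x
  univ_4 V x := by
    simp only [sat_imp, sat_univ]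
    exact fun h _ => h
  univ_B V x := by
    simp only [sat_imp, sat_univ, sat_ex]
    exact fun h _ => ⟨x, h⟩
  univ_box V x := by
    simp only [sat_imp, sat_univ, sat_box]
    exact fun h y _ => h y
  mp _ _ h h' V x := (sat_imp _ _ x).1 (h V x) (h' V x)
  nec_box _ h V _ y _ := h V y
  nec_univ _ h V _ y := h V y
  subst _ _ h V x := (sat_subst _ _ x).2 (h _ x)

theorem sat_of_mem_K4u {W : Type} {R : W → W → Prop} (hR : ∀ x y z, R x y → R y z → R x z)
    {φ : Formula} (h : φ ∈ K4u) (V : ℕ → W → Prop) (x : W) : Sat R V φ x := by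
  refine Set.mem_sInter.1 h _ ⟨isNormalLogic_valid R, fun V x => ?_⟩ V x
  simp only [sat_imp, sat_box]
  exact fun h y hy z hz => h z (hR x y z hy hz)

/-! ## Completeness: the canonical model -/

/-- A set of formulas that contains `L` and is closed under modus ponens. -/
structure IsTheory (L T : Set Formula) : Prop where
  subset : L ⊆ T
  mp : ∀ φ ψ : Formula, imp φ ψ ∈ T → φ ∈ T → ψ ∈ T

/-- A maximal consistent theory over `L`. -/
structure IsMaxTheory (L T : Set Formula) : Prop extends IsTheory L T where
  neg_mem : ∀ φ : Formula, neg φ ∈ T ↔ φ ∉ T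

section Canonical

variable {L : Set Formula}

theorem IsTheory.taut (hL : IsNormalLogic L) {T : Set Formula} (hT : IsTheory L T) {φ : Formula}
    (h : φ.IsTautology) : φ ∈ T :=
  hT.subset (hL.taut φ h)

/-- This is the deduction theorem in disguise: the set plays the role of the theory generated by `T`
and `χ`. -/
theorem IsTheory.extend (hL : IsNormalLogic L) {T : Set Formula} (hT : IsTheory L T)
    (χ : Formula) : IsTheory L {φ | imp χ φ ∈ T} where
  subset φ h := hT.mp φ _ (hT.taut hL fun v => by
    simp only [imp, boolEval]
    generalize boolEval v φ = a, boolEval v χ = b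
    revert a b; decide) (hT.subset h)
  mp φ ψ h h' := by
    refine hT.mp _ _ (hT.mp _ _ (hT.taut hL fun v => ?_) h) h'
    simp only [imp, boolEval]
    generalize boolEval v φ = a, boolEval v χ = b, boolEval v ψ = c
    revert a b c; decide

/-- Lindenbaum's lemma. -/
theorem IsTheory.exists_isMaxTheory (hL : IsNormalLogic L) {T : Set Formula} (hT : IsTheory L T)
    {φ : Formula} (hφ : φ ∉ T) : ∃ U, T ⊆ U ∧ IsMaxTheory L U ∧ φ ∉ U := by
  obtain ⟨U, hTU, hU⟩ := zorn_subset_nonempty {U | IsTheory L U ∧ φ ∉ U} (by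
    intro c hc hchain hne
    refine ⟨⋃₀ c, ⟨⟨?_, ?_⟩, ?_⟩, fun s hs => Set.subset_sUnion_of_mem hs⟩
    · obtain ⟨s, hs⟩ := hne
      exact (hc hs).1.subset.trans (Set.subset_sUnion_of_mem hs)
    · rintro ψ χ ⟨s, hs, h⟩ ⟨t, ht, h'⟩
      rcases hchain.total hs ht with hst | hts
      · exact ⟨t, ht, (hc ht).1.mp _ _ (hst h) h'⟩
      · exact ⟨s, hs, (hc hs).1.mp _ _ h (hts h')⟩
    · rintro ⟨s, hs, h⟩
      exact (hc hs).2 h) T ⟨hT, hφ⟩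
  obtain ⟨hUT, hUφ⟩ := hU.prop
  -- If `χ` is not in `U`, adjoining it gives a larger theory, which by maximality must contain `φ`.
  -- Negation completeness follows, since `χ → φ` and `¬χ → φ` together would give `φ`.
  have key : ∀ χ, χ ∉ U → imp χ φ ∈ U := by
    intro χ hχ
    by_contra hcon
    refine hχ (hU.le_of_ge (y := {ψ | imp χ ψ ∈ U}) ⟨hUT.extend hL χ, hcon⟩ ?_ ?_)
    · exact fun ψ hψ => hUT.mp ψ _ (hUT.taut hL fun v => by
        simp only [imp, boolEval]
        generalize boolEval v ψ = a, boolEval v χ = b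
        revert a b; decide) hψ
    · exact hUT.taut hL fun v => by
        simp only [imp, boolEval]
        generalize boolEval v χ = b
        revert b; decide
  refine ⟨U, hTU, ⟨hUT, fun ψ => ⟨fun hn hp => hUφ ?_, fun hp => ?_⟩⟩, hUφ⟩
  · refine hUT.mp _ _ (hUT.mp _ _ (hUT.taut hL fun v => ?_) hn) hp
    simp only [imp, boolEval]
    generalize boolEval v ψ = a, boolEval v φ = b
    revert a b; decide
  · by_contra hn
    refine hUφ (hUT.mp _ _ (hUT.mp _ _ (hUT.taut hL fun v => ?_) (key _ hp)) (key _ hn))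
    simp only [imp, boolEval]
    generalize boolEval v ψ = a, boolEval v φ = b
    revert a b; decide

theorem IsMaxTheory.and_mem (hL : IsNormalLogic L) {T : Set Formula} (hT : IsMaxTheory L T)
    (φ ψ : Formula) : Formula.and φ ψ ∈ T ↔ φ ∈ T ∧ ψ ∈ T := by
  refine ⟨fun h => ⟨hT.mp _ _ (hT.taut hL fun v => ?_) h, hT.mp _ _ (hT.taut hL fun v => ?_) h⟩,
    fun h => hT.mp _ _ (hT.mp _ _ (hT.taut hL fun v => ?_) h.1) h.2⟩ <;>
  · simp only [imp, boolEval]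
    generalize boolEval v φ = a, boolEval v ψ = b
    revert a b; decide

theorem IsTheory.unbox (hL : IsNormalLogic L) {T : Set Formula} (hT : IsTheory L T) :
    IsTheory L {φ | box φ ∈ T} where
  subset φ h := hT.subset (hL.nec_box φ h)
  mp φ ψ h h' := hT.mp _ _ (hT.mp _ _ (hT.subset
    (hL.subst (fun n => if n = 0 then φ else ψ) _ hL.box_K)) h) h'

theorem IsTheory.ununiv (hL : IsNormalLogic L) {T : Set Formula} (hT : IsTheory L T) :
    IsTheory L {φ | univ φ ∈ T} where
  subset φ h := hT.subset (hL.nec_univ φ h)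
  mp φ ψ h h' := hT.mp _ _ (hT.mp _ _ (hT.subset
    (hL.subst (fun n => if n = 0 then φ else ψ) _ hL.univ_K)) h) h'

theorem IsTheory.of_univ_mem (hL : IsNormalLogic L) {T : Set Formula} (hT : IsTheory L T)
    {φ : Formula} (h : univ φ ∈ T) : φ ∈ T :=
  hT.mp _ _ (hT.subset (hL.subst (fun _ => φ) _ hL.univ_T)) h

theorem IsTheory.univ_univ_mem (hL : IsNormalLogic L) {T : Set Formula} (hT : IsTheory L T)
    {φ : Formula} (h : univ φ ∈ T) : univ (univ φ) ∈ T :=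
  hT.mp _ _ (hT.subset (hL.subst (fun _ => φ) _ hL.univ_4)) h

theorem IsTheory.box_mem_of_univ_mem (hL : IsNormalLogic L) {T : Set Formula}
    (hT : IsTheory L T) {φ : Formula} (h : univ φ ∈ T) : box φ ∈ T :=
  hT.mp _ _ (hT.subset (hL.subst (fun _ => φ) _ hL.univ_box)) h

/-- The relation interpreting `∀` in the canonical model is symmetric. -/
theorem IsMaxTheory.univ_symm (hL : IsNormalLogic L) {T U : Set Formula} (hT : IsMaxTheory L T)
    (hU : IsMaxTheory L U) (h : {φ | univ φ ∈ T} ⊆ U) : {φ | univ φ ∈ U} ⊆ T := by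
  intro φ hφ
  by_contra hn
  have h₁ : univ (ex (neg φ)) ∈ T :=
    hT.mp _ _ (hT.subset (hL.subst (fun _ => neg φ) _ hL.univ_B)) ((hT.neg_mem φ).2 hn)
  refine (hU.neg_mem _).1 (h h₁) (hU.mp (univ φ) _ (hU.mp _ _ ?_ (hU.subset
    (hL.nec_univ (imp φ (neg (neg φ))) (hL.taut _ fun v => ?_)))) hφ)
  · exact hU.subset (hL.subst (fun n => if n = 0 then φ else neg (neg φ)) _ hL.univ_K)
  · simp only [imp, boolEval]
    generalize boolEval v φ = a
    revert a; decide

/-- The points of the canonical model generated by `Γ`. -/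
def CanonicalWorld (L Γ : Set Formula) : Type :=
  {T : Set Formula // IsMaxTheory L T ∧ {φ | univ φ ∈ Γ} ⊆ T}

/-- The truth lemma. Restricting to the worlds above `Γ` turns the relation for ∀ into the universal
one, by axioms 4 and B. -/
theorem sat_canonical (hL : IsNormalLogic L) {Γ : Set Formula} (hΓ : IsMaxTheory L Γ)
    (φ : Formula) (T : CanonicalWorld L Γ) :
    Sat (fun T U : CanonicalWorld L Γ => {φ | box φ ∈ T.1} ⊆ U.1)
      (fun n (T : CanonicalWorld L Γ) => var n ∈ T.1) φ T ↔ φ ∈ T.1 := by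
  induction φ generalizing T with
  | var n => rfl
  | neg φ ih => rw [sat_neg, ih, T.2.1.neg_mem]
  | and φ ψ ih₁ ih₂ => rw [sat_and, ih₁, ih₂, T.2.1.and_mem hL]
  | box φ ih =>
    simp only [sat_box, ih]
    refine ⟨fun h => ?_, fun h U hU => hU h⟩
    by_contra hn
    obtain ⟨U, hTU, hU, hφ⟩ := (T.2.1.unbox hL).exists_isMaxTheory hL (φ := φ) hn
    -- The successor stays among the worlds above `Γ`: `∀ψ ∈ Γ` gives `∀∀ψ ∈ Γ`, then `∀ψ ∈ T`, then
    -- `□ψ ∈ T`.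
    refine hφ (h ⟨U, hU, fun ψ hψ => hTU (T.2.1.box_mem_of_univ_mem hL ?_)⟩ hTU)
    exact T.2.2 (hΓ.univ_univ_mem hL hψ)
  | univ φ ih =>
    simp only [sat_univ, ih]
    have hTΓ := hΓ.univ_symm hL T.2.1 T.2.2
    refine ⟨fun h => ?_, fun h U => U.2.2 (hTΓ (T.2.1.univ_univ_mem hL h))⟩
    by_contra hn
    obtain ⟨U, hTU, hU, hφ⟩ := (T.2.1.ununiv hL).exists_isMaxTheory hL (φ := φ) hn
    refine hφ (h ⟨U, hU, fun ψ hψ => hTU (T.2.2 (hΓ.univ_univ_mem hL hψ))⟩)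

/-- Every normal logic with the universal modality contains all formulas valid in all Kripke
models. -/
theorem IsNormalLogic.mem_of_forall_sat (hL : IsNormalLogic L) {φ : Formula}
    (h : ∀ (W : Type) (R : W → W → Prop) (V : ℕ → W → Prop) (x : W), Sat R V φ x) : φ ∈ L := by
  by_contra hn
  obtain ⟨Γ, -, hΓ, hφ⟩ :=
    (IsTheory.mk subset_rfl hL.mp : IsTheory L L).exists_isMaxTheory hL hn
  exact hφ ((sat_canonical hL hΓ φ ⟨Γ, hΓ, fun ψ hψ => hΓ.of_univ_mem hL hψ⟩).1 (h _ _ _ _))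

end Canonical


/-! ## Horn clauses over the natural numbers -/

/-- Terms denoting natural numbers. -/
inductive Term : Type
  | var (i : ℕ) : Term
  | zero : Term
  | succ (t : Term) : Term

namespace Term

/-- The value of a term under an assignment. -/
def eval (v : ℕ → ℕ) : Term → ℕ
  | var i => v i
  | zero => 0
  | succ t => t.eval v + 1

/-- The variables of a term. -/
def vars : Term → List ℕ
  | var i => [i]
  | zero => []
  | succ t => t.vars

/-- The term `t + n`. -/
def add (t : Term) : ℕ → Term
  | 0 => t
  | n + 1 => succ (t.add n)

/-- The numeral of `n`. -/
abbrev num (n : ℕ) : Term := zero.add n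

theorem eval_add (v : ℕ → ℕ) (t : Term) (n : ℕ) : (t.add n).eval v = t.eval v + n := by
  induction n with
  | zero => rfl
  | succ n ih => simp [add, eval, ih, Nat.add_assoc]

theorem eval_num (v : ℕ → ℕ) (n : ℕ) : (num n).eval v = n := by
  simp [num, eval_add, eval]

end Term

/-- Quadruples; the first component serves as the name of a predicate. -/
structure Atom (α : Type) : Type where
  fst : α
  snd : α
  thd : α
  fth : α

namespace Atom

/-- Componentwise application of a function. -/
def map {α β : Type} (f : α → β) (a : Atom α) : Atom β := ⟨f a.fst, f a.snd, f a.thd, f a.fth⟩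

/-- The ground instance of an atom under an assignment. -/
abbrev eval (v : ℕ → ℕ) (a : Atom Term) : Atom ℕ := a.map (Term.eval v)

/-- The variables of an atom. -/
def vars (a : Atom Term) : List ℕ := a.fst.vars ++ a.snd.vars ++ a.thd.vars ++ a.fth.vars

/-- A ground atom written with numerals. -/
abbrev quote (a : Atom ℕ) : Atom Term := a.map Term.num

end Atom

/-- A Horn clause. -/
structure Clause : Type where
  prem : List (Atom Term)
  concl : Atom Term

/-- The set `S` of ground atoms is closed under the ground instance of `c` given by `v`. -/
def Clause.Closed (c : Clause) (v : ℕ → ℕ) (S : Set (Atom ℕ)) : Prop :=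
  (∀ a ∈ c.prem, a.eval v ∈ S) → c.concl.eval v ∈ S

/-- All variables of the conclusion occur in the premises. -/
def Clause.Safe (c : Clause) : Prop := ∀ i ∈ c.concl.vars, ∃ a ∈ c.prem, i ∈ a.vars

instance : DecidablePred Clause.Safe := fun c =>
  inferInstanceAs (Decidable (∀ i ∈ c.concl.vars, ∃ a ∈ c.prem, i ∈ a.vars))

/-- Derivability of ground atoms from a list of clauses. -/
inductive Derivable (P : List Clause) : Atom ℕ → Prop
  | step (c : Clause) (hc : c ∈ P) (v : ℕ → ℕ) (h : ∀ a ∈ c.prem, Derivable P (a.eval v)) :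
      Derivable P (c.concl.eval v)

theorem Derivable.mem {P : List Clause} {S : Set (Atom ℕ)} (hS : ∀ c ∈ P, ∀ v, c.Closed v S)
    {q : Atom ℕ} (h : Derivable P q) : q ∈ S := by
  induction h with
  | step c hc v _ ih => exact hS c hc v ih

/-- A derivation uses finitely many ground instances of clauses. -/
theorem Derivable.exists_instances {P : List Clause} {q : Atom ℕ} (h : Derivable P q) :
    ∃ l : List (Clause × (ℕ → ℕ)), (∀ x ∈ l, x.1 ∈ P) ∧
      ∀ S : Set (Atom ℕ), (∀ x ∈ l, x.1.Closed x.2 S) → q ∈ S := by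
  induction h with
  | step c hc v _ ih =>
    choose! f hf using ih
    refine ⟨(c, v) :: c.prem.flatMap f, ?_, fun S hS => ?_⟩
    · simp only [List.mem_cons, List.mem_flatMap]
      rintro x (rfl | ⟨a, ha, hx⟩)
      exacts [hc, (hf a ha).1 x hx]
    · refine hS (c, v) List.mem_cons_self fun a ha => (hf a ha).2 S fun x hx => ?_
      exact hS x (List.mem_cons_of_mem _ (List.mem_flatMap.2 ⟨a, ha, hx⟩))

/-! ## A Horn program for the evaluation of codes of partial recursive functions -/

section Program

open Term

/-- `E c x y`: the function with code `c` maps `x` to `y`. -/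
def evalAtom {α : Type} (n : ℕ → α) (c x y : α) : Atom α := ⟨n 0, c, x, y⟩

/-- `P a b n`: `n` is the code of the pair `(a, b)`. -/
def pairAtom {α : Type} (n : ℕ → α) (a b p : α) : Atom α := ⟨n 1, a, b, p⟩

/-- `L a b`: `a < b`. -/
def ltAtom {α : Type} (n : ℕ → α) (a b : α) : Atom α := ⟨n 2, a, b, n 0⟩

/-- `Q a b`: `b = 4 * a`. -/
def quadAtom {α : Type} (n : ℕ → α) (a b : α) : Atom α := ⟨n 3, a, b, n 0⟩

/-- `H c`: the function with code `c` is defined at `0`. -/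
def haltAtom {α : Type} (n : ℕ → α) (c : α) : Atom α := ⟨n 4, c, n 0, n 0⟩

/-- `N a`: `a` is a natural number. -/
def natAtom {α : Type} (n : ℕ → α) (a : α) : Atom α := ⟨n 5, a, n 0, n 0⟩

local notation "E" => evalAtom num
local notation "P" => pairAtom num
local notation "L" => ltAtom num
local notation "Q" => quadAtom num
local notation "H" => haltAtom num
local notation "N" => natAtom num
local notation "x₀" => Term.var 0
local notation "x₁" => Term.var 1
local notation "x₂" => Term.var 2
local notation "x₃" => Term.var 3
local notation "x₄" => Term.var 4
local notation "x₅" => Term.var 5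
local notation "x₆" => Term.var 6
local notation "x₇" => Term.var 7
local notation "x₈" => Term.var 8
local notation "x₉" => Term.var 9

/-- Clauses for the arithmetical predicates. -/
def arithmetic : List Clause := [
  ⟨[], N zero⟩,
  ⟨[N x₀], N (succ x₀)⟩,
  ⟨[N x₀], L zero (succ x₀)⟩,
  ⟨[L x₀ x₁], L (succ x₀) (succ x₁)⟩,
  ⟨[], P zero zero zero⟩,
  ⟨[P x₀ x₁ x₂, L (succ x₀) x₁], P (succ x₀) x₁ (succ x₂)⟩,
  ⟨[P x₀ (succ x₀) x₁], P (succ x₀) zero (succ x₁)⟩,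
  ⟨[P x₀ x₁ x₂, L x₁ x₀], P x₀ (succ x₁) (succ x₂)⟩,
  ⟨[P x₀ x₀ x₁], P zero (succ x₀) (succ x₁)⟩,
  ⟨[], Q zero zero⟩,
  ⟨[Q x₀ x₁], Q (succ x₀) (Term.add x₁ 4)⟩]

/-- Clauses following the definition of `Nat.Partrec.Code.eval`. -/
def evaluation : List Clause := [
  ⟨[N x₀], E zero x₀ zero⟩,
  ⟨[N x₀], E (num 1) x₀ (succ x₀)⟩,
  ⟨[P x₀ x₁ x₂], E (num 2) x₂ x₀⟩,
  ⟨[P x₀ x₁ x₂], E (num 3) x₂ x₁⟩,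
  ⟨[P x₀ x₁ x₂, Q x₂ x₃, E x₀ x₄ x₅, E x₁ x₄ x₆, P x₅ x₆ x₇], E (Term.add x₃ 4) x₄ x₇⟩,
  ⟨[P x₀ x₁ x₂, Q x₂ x₃, E x₁ x₄ x₅, E x₀ x₅ x₆], E (Term.add x₃ 6) x₄ x₆⟩,
  ⟨[P x₀ x₁ x₂, Q x₂ x₃, P x₄ zero x₅, E x₀ x₄ x₆], E (Term.add x₃ 5) x₅ x₆⟩,
  ⟨[P x₀ x₁ x₂, Q x₂ x₃, P x₄ (succ x₅) x₆, P x₄ x₅ x₇, E (Term.add x₃ 5) x₇ x₈, P x₅ x₈ x₉,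
    P x₄ x₉ (Term.var 10), E x₁ (Term.var 10) (Term.var 11)], E (Term.add x₃ 5) x₆ (Term.var 11)⟩,
  ⟨[Q x₀ x₁, P x₂ x₃ x₄, E x₀ x₄ zero], E (Term.add x₁ 7) x₄ x₃⟩,
  ⟨[Q x₀ x₁, P x₂ x₃ x₄, E x₀ x₄ (succ x₅), P x₂ (succ x₃) x₆, E (Term.add x₁ 7) x₆ x₇],
    E (Term.add x₁ 7) x₄ x₇⟩,
  ⟨[E x₀ zero x₁], H x₀⟩]

end Program

/-- The Horn program. -/
def program : List Clause := arithmetic ++ evaluation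

/-- Safety is the reason for the `natAtom` premises: they bind variables that would otherwise occur
only in a conclusion. -/
theorem program_safe : ∀ c ∈ program, c.Safe := by decide

open Nat.Partrec (Code)
open Encodable (encode)

/-- The intended interpretation of the program. -/
def trueAtoms : Set (Atom ℕ) := {q | match q.fst with
  | 0 => q.fth ∈ Code.eval (Denumerable.ofNat Code q.snd) q.thd
  | 1 => Nat.pair q.snd q.thd = q.fth
  | 2 => q.snd < q.thd
  | 3 => q.thd = 4 * q.snd
  | 4 => (Code.eval (Denumerable.ofNat Code q.snd) 0).Dom
  | _ => True}

/-! ### Soundness of the program -/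

section TrueAtoms

variable {a b c x y : ℕ}

theorem evalAtom_mem : evalAtom id c x y ∈ trueAtoms ↔
    y ∈ Code.eval (Denumerable.ofNat Code c) x := Iff.rfl

theorem pairAtom_mem : pairAtom id a b c ∈ trueAtoms ↔ Nat.pair a b = c := Iff.rfl

theorem ltAtom_mem : ltAtom id a b ∈ trueAtoms ↔ a < b := Iff.rfl

theorem quadAtom_mem : quadAtom id a b ∈ trueAtoms ↔ b = 4 * a := Iff.rfl

theorem haltAtom_mem : haltAtom id c ∈ trueAtoms ↔
    (Code.eval (Denumerable.ofNat Code c) 0).Dom := Iff.rfl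

theorem natAtom_mem : natAtom id c ∈ trueAtoms := trivial

/-- The codes 0 to 3 are the basic functions. Above them, after subtracting 4, the remainder modulo
4 names the constructor, whence the offsets 4, 5, 6, 7. -/
theorem ofNat_pair : Denumerable.ofNat Code (4 * Nat.pair a b + 4) =
    Code.pair (Denumerable.ofNat Code a) (Denumerable.ofNat Code b) := by
  rw [← Denumerable.ofNat_encode (Code.pair _ _)]
  congr 1
  simp only [Code.encodeCode_eq, Code.encodeCode]
  simp only [← Code.encodeCode_eq, Denumerable.encode_ofNat]
  ring

theorem ofNat_comp : Denumerable.ofNat Code (4 * Nat.pair a b + 6) =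
    Code.comp (Denumerable.ofNat Code a) (Denumerable.ofNat Code b) := by
  rw [← Denumerable.ofNat_encode (Code.comp _ _)]
  congr 1
  simp only [Code.encodeCode_eq, Code.encodeCode]
  simp only [← Code.encodeCode_eq, Denumerable.encode_ofNat]
  ring

theorem ofNat_prec : Denumerable.ofNat Code (4 * Nat.pair a b + 5) =
    Code.prec (Denumerable.ofNat Code a) (Denumerable.ofNat Code b) := by
  rw [← Denumerable.ofNat_encode (Code.prec _ _)]
  congr 1
  simp only [Code.encodeCode_eq, Code.encodeCode]
  simp only [← Code.encodeCode_eq, Denumerable.encode_ofNat]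
  ring

theorem ofNat_rfind : Denumerable.ofNat Code (4 * a + 7) =
    Code.rfind' (Denumerable.ofNat Code a) := by
  rw [← Denumerable.ofNat_encode (Code.rfind' _)]
  congr 1
  simp only [Code.encodeCode_eq, Code.encodeCode]
  simp only [← Code.encodeCode_eq, Denumerable.encode_ofNat]
  ring

end TrueAtoms

theorem mem_eval_pair {f g : Code} {x y : ℕ} : y ∈ (Code.pair f g).eval x ↔
    ∃ a ∈ f.eval x, ∃ b ∈ g.eval x, Nat.pair a b = y := by
  simp [Code.eval, Seq.seq]

theorem mem_eval_comp {f g : Code} {x y : ℕ} : y ∈ (Code.comp f g).eval x ↔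
    ∃ a ∈ g.eval x, y ∈ f.eval a := by
  exact Part.mem_bind_iff

theorem mem_eval_prec_succ {f g : Code} {a k y : ℕ} :
    y ∈ (Code.prec f g).eval (Nat.pair a (k + 1)) ↔
      ∃ i ∈ (Code.prec f g).eval (Nat.pair a k), y ∈ g.eval (Nat.pair a (Nat.pair k i)) := by
  rw [← Nat.succ_eq_add_one, Code.eval_prec_succ]
  simp

theorem mem_eval_rfind' {f : Code} {a m y : ℕ} : y ∈ (Code.rfind' f).eval (Nat.pair a m) ↔
    ∃ n, n + m = y ∧ 0 ∈ f.eval (Nat.pair a (n + m)) ∧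
      ∀ k < n, ∃ s, s + 1 ∈ f.eval (Nat.pair a (k + m)) := by
  have h0 (k : ℕ) : true ∈ ((fun m => decide (m = 0)) <$> f.eval (Nat.pair a (k + m))) ↔
      0 ∈ f.eval (Nat.pair a (k + m)) := by
    simp [Part.map_eq_map, Part.mem_map_iff]
  have h1 (k : ℕ) : false ∈ ((fun m => decide (m = 0)) <$> f.eval (Nat.pair a (k + m))) ↔
      ∃ s, s + 1 ∈ f.eval (Nat.pair a (k + m)) := by
    simp only [Part.map_eq_map, Part.mem_map_iff, decide_eq_false_iff_not]
    refine ⟨?_, fun ⟨s, hs⟩ => ⟨_, hs, by simp⟩⟩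
    rintro ⟨s, hs, hne⟩
    obtain ⟨t, rfl⟩ := Nat.exists_eq_succ_of_ne_zero hne
    exact ⟨t, hs⟩
  simp only [Code.eval, Nat.unpaired, Nat.unpair_pair, Part.mem_map_iff]
  refine exists_congr fun n => ?_
  rw [and_comm]
  exact and_congr_right fun _ =>
    Nat.mem_rfind.trans (and_congr (h0 n) (forall₂_congr fun k _ => h1 k))

theorem mem_eval_rfind'_zero {f : Code} {a m : ℕ} (h : 0 ∈ f.eval (Nat.pair a m)) :
    m ∈ (Code.rfind' f).eval (Nat.pair a m) :=
  mem_eval_rfind'.2 ⟨0, by simp, by simpa using h, by simp⟩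

theorem mem_eval_rfind'_succ {f : Code} {a m s y : ℕ} (h : s + 1 ∈ f.eval (Nat.pair a m))
    (h' : y ∈ (Code.rfind' f).eval (Nat.pair a (m + 1))) :
    y ∈ (Code.rfind' f).eval (Nat.pair a m) := by
  obtain ⟨n, rfl, h0, hk⟩ := mem_eval_rfind'.1 h'
  refine mem_eval_rfind'.2 ⟨n + 1, by ring, by convert h0 using 3; ring, fun k hkn => ?_⟩
  cases k with
  | zero => exact ⟨s, by simpa using h⟩
  | succ k =>
    obtain ⟨t, ht⟩ := hk k (by omega)
    exact ⟨t, by convert ht using 3; ring⟩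

/-- `Nat.pair` enumerates square shells: shell `m` runs through `(0, m), …, (m-1, m)`, then `(m, 0),
…, (m, m)`. The four successor equations follow this path and justify the clauses for `pairAtom`. -/
theorem pair_succ_of_lt {a b : ℕ} (h : a + 1 < b) : Nat.pair (a + 1) b = Nat.pair a b + 1 := by
  rw [Nat.pair, Nat.pair, if_pos h, if_pos (by omega)]; ring

theorem pair_succ_self (a : ℕ) : Nat.pair (a + 1) 0 = Nat.pair a (a + 1) + 1 := by
  rw [Nat.pair, Nat.pair, if_neg (by omega), if_pos (by omega)]; ring

theorem pair_succ_of_gt {a b : ℕ} (h : b < a) : Nat.pair a (b + 1) = Nat.pair a b + 1 := by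
  rw [Nat.pair, Nat.pair, if_neg (by omega), if_neg (by omega)]; ring

theorem pair_zero_succ (a : ℕ) : Nat.pair 0 (a + 1) = Nat.pair a a + 1 := by
  rw [Nat.pair, Nat.pair, if_pos (by omega), if_neg (by omega)]; ring

section Closed

variable (v : ℕ → ℕ) (s t u : Term)

theorem eval_evalAtom : (evalAtom Term.num s t u).eval v =
    evalAtom id (s.eval v) (t.eval v) (u.eval v) := by
  simp [evalAtom, Atom.eval, Atom.map, Term.eval_num]

theorem eval_pairAtom : (pairAtom Term.num s t u).eval v =
    pairAtom id (s.eval v) (t.eval v) (u.eval v) := by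
  simp [pairAtom, Atom.eval, Atom.map, Term.eval_num]

theorem eval_ltAtom : (ltAtom Term.num s t).eval v = ltAtom id (s.eval v) (t.eval v) := by
  simp [ltAtom, Atom.eval, Atom.map, Term.eval_num]

theorem eval_quadAtom : (quadAtom Term.num s t).eval v = quadAtom id (s.eval v) (t.eval v) := by
  simp [quadAtom, Atom.eval, Atom.map, Term.eval_num]

theorem eval_haltAtom : (haltAtom Term.num s).eval v = haltAtom id (s.eval v) := by
  simp [haltAtom, Atom.eval, Atom.map, Term.eval_num]

theorem eval_natAtom : (natAtom Term.num s).eval v = natAtom id (s.eval v) := by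
  simp [natAtom, Atom.eval, Atom.map, Term.eval_num]

end Closed

theorem arithmetic_closed : ∀ c ∈ arithmetic, ∀ v, c.Closed v trueAtoms := by
  simp only [arithmetic, List.forall_mem_cons, Clause.Closed, List.not_mem_nil,
    IsEmpty.forall_iff, implies_true, and_true, forall_const, eval_natAtom, eval_ltAtom,
    eval_pairAtom, eval_quadAtom, natAtom_mem, ltAtom_mem, pairAtom_mem, quadAtom_mem, Term.eval,
    Term.eval_add, true_and]
  refine ⟨fun v => by omega, fun v h => by omega, rfl, ?_, ?_, ?_, ?_, fun v h => by omega⟩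
  · rintro v ⟨h, h'⟩
    rw [pair_succ_of_lt h', h]
  · rintro v h
    rw [pair_succ_self, h]
  · rintro v ⟨h, h'⟩
    rw [pair_succ_of_gt h', h]
  · rintro v h
    rw [pair_zero_succ, h]

theorem evaluation_closed : ∀ c ∈ evaluation, ∀ v, c.Closed v trueAtoms := by
  simp only [evaluation, List.forall_mem_cons, Clause.Closed, List.not_mem_nil,
    IsEmpty.forall_iff, implies_true, and_true, forall_const, eval_natAtom, eval_evalAtom,
    eval_haltAtom,
    eval_pairAtom, eval_quadAtom, natAtom_mem, evalAtom_mem, pairAtom_mem, quadAtom_mem,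
    haltAtom_mem, Term.eval, Term.eval_add]
  refine ⟨?_, ?_, ?_, ?_, ?_, ?_, ?_, ?_, ?_, ?_, ?_⟩
  · intro v
    rw [show Denumerable.ofNat Code 0 = Code.zero from Denumerable.ofNat_encode Code.zero]
    exact Part.mem_some 0
  · intro v
    rw [show Denumerable.ofNat Code (0 + 1) = Code.succ from Denumerable.ofNat_encode Code.succ]
    exact Part.mem_some _
  · rintro v h
    rw [← h, show Denumerable.ofNat Code 2 = Code.left from Denumerable.ofNat_encode Code.left]
    exact Part.mem_some_iff.2 (by simp only [Nat.unpair_pair])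
  · rintro v h
    rw [← h, show Denumerable.ofNat Code 3 = Code.right from Denumerable.ofNat_encode Code.right]
    exact Part.mem_some_iff.2 (by simp only [Nat.unpair_pair])
  · rintro v ⟨h, h', ha, hb, hy⟩
    rw [h', ← h, ofNat_pair, mem_eval_pair]
    exact ⟨_, ha, _, hb, hy⟩
  · rintro v ⟨h, h', ha, hb⟩
    rw [h', ← h, ofNat_comp, mem_eval_comp]
    exact ⟨_, ha, hb⟩
  · rintro v ⟨h, h', hn, ha⟩
    rw [h', ← h, ofNat_prec, ← hn, Code.eval_prec_zero]
    exact ha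
  · rintro v ⟨h, h', hn, hn', hi, hs, ht, hy⟩
    rw [h', ← h, ofNat_prec] at hi ⊢
    rw [← hn, mem_eval_prec_succ]
    rw [← ht, ← hs] at hy
    exact ⟨_, hn' ▸ hi, hy⟩
  · rintro v ⟨h, hn, h0⟩
    rw [h, ofNat_rfind, ← hn]
    exact mem_eval_rfind'_zero (hn ▸ h0)
  · rintro v ⟨h, hn, hs, hn', hy⟩
    rw [h, ofNat_rfind] at hy ⊢
    rw [← hn] at hs ⊢
    exact mem_eval_rfind'_succ hs (hn' ▸ hy)
  · exact fun v h => Part.dom_iff_mem.2 ⟨_, h⟩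

/-- The assignment given by a list of values. -/
abbrev assign (l : List ℕ) (i : ℕ) : ℕ := l.getD i 0

/-- The index `n` is the position in the program: 0 to 10 are arithmetical clauses, 11 to 21
evaluation clauses. The list `l` gives the values of the clause's variables. -/
theorem derivable_of_program (n : Fin 22) (l : List ℕ)
    (h : program[n].prem.Forall fun a => Derivable program (a.eval (assign l))) {q : Atom ℕ}
    (hq : program[n].concl.eval (assign l) = q) : Derivable program q :=
  hq ▸ Derivable.step program[n] (List.getElem_mem _) _ (List.forall_iff_forall_mem.1 h)

/-! ### Completeness of the program -/

theorem derivable_nat (a : ℕ) : Derivable program (natAtom id a) := by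
  induction a with
  | zero => exact derivable_of_program 0 [] trivial rfl
  | succ a ih => exact derivable_of_program 1 [a] ih rfl

theorem derivable_lt {a b : ℕ} (h : a < b) : Derivable program (ltAtom id a b) := by
  obtain ⟨b, rfl⟩ := Nat.exists_eq_succ_of_ne_zero (by omega : b ≠ 0)
  induction a generalizing b with
  | zero => exact derivable_of_program 2 [b] (derivable_nat b) rfl
  | succ a ih =>
    obtain ⟨b, rfl⟩ := Nat.exists_eq_succ_of_ne_zero (by omega : b ≠ 0)
    exact derivable_of_program 3 [a, b + 1] (ih b (by omega)) rfl

theorem derivable_pair (a b : ℕ) : Derivable program (pairAtom id a b (Nat.pair a b)) := by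
  generalize hn : Nat.pair a b = n
  induction n using Nat.strong_induction_on generalizing a b with
  | _ n ih =>
    have ih (a b : ℕ) (h : Nat.pair a b + 1 = n) :
        Derivable program (pairAtom id a b (Nat.pair a b)) := ih _ (by omega) a b rfl
    subst hn
    rcases lt_or_ge a b with hab | hab
    · cases a with
      | zero =>
        obtain ⟨b, rfl⟩ := Nat.exists_eq_succ_of_ne_zero (by omega : b ≠ 0)
        have h := pair_zero_succ b
        exact derivable_of_program 8 [b, Nat.pair b b] (ih b b h.symm)
          (congrArg (pairAtom id 0 (b + 1)) h.symm)
      | succ a =>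
        have h := pair_succ_of_lt hab
        exact derivable_of_program 5 [a, b, Nat.pair a b]
          (And.intro (ih a b h.symm) (derivable_lt hab))
          (congrArg (pairAtom id (a + 1) b) h.symm)
    · cases b with
      | zero =>
        cases a with
        | zero => exact derivable_of_program 4 [] trivial rfl
        | succ a =>
          have h := pair_succ_self a
          exact derivable_of_program 6 [a, Nat.pair a (a + 1)] (ih a (a + 1) h.symm)
            (congrArg (pairAtom id (a + 1) 0) h.symm)
      | succ b =>
        have h := pair_succ_of_gt hab
        exact derivable_of_program 7 [a, b, Nat.pair a b]
          (And.intro (ih a b h.symm) (derivable_lt hab))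
          (congrArg (pairAtom id a (b + 1)) h.symm)

theorem derivable_quad (a : ℕ) : Derivable program (quadAtom id a (4 * a)) := by
  induction a with
  | zero => exact derivable_of_program 9 [] trivial rfl
  | succ a ih => exact derivable_of_program 10 [a, 4 * a] ih rfl

theorem encode_pair (f g : Code) : encode (Code.pair f g) =
    4 * Nat.pair (encode f) (encode g) + 4 := by
  simp only [Code.encodeCode_eq, Code.encodeCode]; ring

theorem encode_comp (f g : Code) : encode (Code.comp f g) =
    4 * Nat.pair (encode f) (encode g) + 6 := by
  simp only [Code.encodeCode_eq, Code.encodeCode]; ring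

theorem encode_prec (f g : Code) : encode (Code.prec f g) =
    4 * Nat.pair (encode f) (encode g) + 5 := by
  simp only [Code.encodeCode_eq, Code.encodeCode]; ring

theorem encode_rfind' (f : Code) : encode (Code.rfind' f) =
    4 * encode f + 7 := by
  simp only [Code.encodeCode_eq, Code.encodeCode]; ring

theorem derivable_eval (c : Code) (x y : ℕ) (h : y ∈ c.eval x) :
    Derivable program (evalAtom id (encode c) x y) := by
  induction c generalizing x y with
  | zero =>
    obtain rfl : y = 0 := Part.mem_some_iff.1 h
    exact derivable_of_program 11 [x] (derivable_nat x) rfl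
  | succ =>
    obtain rfl : y = x + 1 := Part.mem_some_iff.1 h
    exact derivable_of_program 12 [x] (derivable_nat x) rfl
  | left =>
    obtain rfl : y = x.unpair.1 := Part.mem_some_iff.1 h
    have hx := derivable_pair x.unpair.1 x.unpair.2
    rw [Nat.pair_unpair] at hx
    exact derivable_of_program 13 [x.unpair.1, x.unpair.2, x] hx rfl
  | right =>
    obtain rfl : y = x.unpair.2 := Part.mem_some_iff.1 h
    have hx := derivable_pair x.unpair.1 x.unpair.2
    rw [Nat.pair_unpair] at hx
    exact derivable_of_program 14 [x.unpair.1, x.unpair.2, x] hx rfl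
  | pair f g ihf ihg =>
    obtain ⟨a, ha, b, hb, rfl⟩ := mem_eval_pair.1 h
    rw [encode_pair]
    exact derivable_of_program 15
        [encode f, encode g, Nat.pair (encode f) (encode g), 4 * Nat.pair (encode f) (encode g),
          x, a, b, Nat.pair a b]
      (And.intro (derivable_pair _ _) (And.intro (derivable_quad _) (And.intro (ihf x a ha)
        (And.intro (ihg x b hb) (derivable_pair a b))))) rfl
  | comp f g ihf ihg =>
    obtain ⟨a, ha, hy⟩ := mem_eval_comp.1 h
    rw [encode_comp]
    exact derivable_of_program 16
        [encode f, encode g, Nat.pair (encode f) (encode g), 4 * Nat.pair (encode f) (encode g),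
          x, a, y]
      (And.intro (derivable_pair _ _) (And.intro (derivable_quad _) (And.intro (ihg x a ha)
        (ihf a y hy)))) rfl
  | prec f g ihf ihg =>
    rw [encode_prec]
    obtain ⟨a, k, rfl⟩ : ∃ a k, x = Nat.pair a k := ⟨_, _, (Nat.pair_unpair x).symm⟩
    induction k generalizing y with
    | zero =>
      rw [Code.eval_prec_zero] at h
      exact derivable_of_program 17
        [encode f, encode g, Nat.pair (encode f) (encode g), 4 * Nat.pair (encode f) (encode g),
          a, Nat.pair a 0, y]
        (And.intro (derivable_pair _ _) (And.intro (derivable_quad _)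
          (And.intro (derivable_pair a 0) (ihf a y h)))) rfl
    | succ k ihk =>
      obtain ⟨i, hi, hy⟩ := mem_eval_prec_succ.1 h
      exact derivable_of_program 18
        [encode f, encode g, Nat.pair (encode f) (encode g), 4 * Nat.pair (encode f) (encode g),
          a, k, Nat.pair a (k + 1), Nat.pair a k, i,
          Nat.pair k i, Nat.pair a (Nat.pair k i), y]
        (And.intro (derivable_pair _ _) (And.intro (derivable_quad _)
          (And.intro (derivable_pair a (k + 1)) (And.intro (derivable_pair a k)
            (And.intro (ihk i hi) (And.intro (derivable_pair k i)
              (And.intro (derivable_pair a _) (ihg _ y hy)))))))) rfl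
  | rfind' f ihf =>
    rw [encode_rfind']
    obtain ⟨a, m, rfl⟩ : ∃ a m, x = Nat.pair a m := ⟨_, _, (Nat.pair_unpair x).symm⟩
    obtain ⟨n, rfl, h0, hs⟩ := mem_eval_rfind'.1 h
    clear h
    induction n generalizing m with
    | zero =>
      rw [Nat.zero_add] at h0 ⊢
      exact derivable_of_program 19 [encode f, 4 * encode f, a, m, Nat.pair a m]
        (And.intro (derivable_quad _) (And.intro (derivable_pair a m) (ihf _ 0 h0))) rfl
    | succ n ihn =>
      obtain ⟨s, hs0⟩ := hs 0 (by omega)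
      rw [Nat.zero_add] at hs0
      rw [Nat.add_right_comm n 1 m] at h0 ⊢
      -- A search from `m` that succeeds after `n + 1` steps is one from `m + 1` that succeeds after
      -- `n`.
      have hn := ihn (m + 1) h0 fun k hk => by
        rw [← Nat.add_assoc, Nat.add_right_comm]
        exact hs (k + 1) (by omega)
      exact derivable_of_program 20
        [encode f, 4 * encode f, a, m, Nat.pair a m, s, Nat.pair a (m + 1), n + (m + 1)]
        (And.intro (derivable_quad _) (And.intro (derivable_pair a m) (And.intro (ihf _ _ hs0)
          (And.intro (derivable_pair a (m + 1)) hn)))) rfl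

/-- The program derives exactly the true statements about halting. -/
theorem derivable_halt_iff (c : Code) :
    Derivable program (haltAtom id (encode c)) ↔ (c.eval 0).Dom := by
  refine ⟨fun h => ?_, fun h => ?_⟩
  · have := h.mem (S := trueAtoms) fun d hd v => (List.mem_append.1 hd).elim
      (fun hd => arithmetic_closed d hd v) fun hd => evaluation_closed d hd v
    rwa [haltAtom_mem, Denumerable.ofNat_encode] at this
  · obtain ⟨y, hy⟩ := Part.dom_iff_mem.1 h
    exact derivable_of_program 21 [encode c, y] (derivable_eval c 0 y hy) rfl


/-! ## Modal encoding of Horn clauses -/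

/-- The constant `⊤`. -/
def top : Formula := neg (Formula.and (var 0) (neg (var 0)))

/-- The dual of `□`. -/
def dia (φ : Formula) : Formula := neg (box (neg φ))

/-- The conjunction of a list of formulas. -/
def conj : List Formula → Formula
  | [] => top
  | φ :: l => Formula.and φ (conj l)

/-- The points of `κ` without `R`-successors satisfying `κ ∧ φ`. -/
def minimal (κ φ : Formula) : Formula := Formula.and κ (neg (dia (Formula.and κ φ)))

/-- The immediate `R`-predecessors of `φ` within `κ`. -/
def next (κ φ : Formula) : Formula := Formula.and κ (Formula.and (dia φ) (neg (dia (dia φ))))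

/-- The formula expressing that a point is the `n`-th element of the chain `κ`. -/
def rung (κ : Formula) : ℕ → Formula
  | 0 => minimal κ κ
  | n + 1 => next κ (rung κ n)

/-- Describes the reflexive end point. -/
def loopF : Formula := Formula.and (dia top) (box (dia top))

/-- Describes the points representing numbers. -/
def numF : Formula := Formula.and (dia top) (Formula.and (neg loopF) (neg (dia loopF)))

/-- Describes the points marking the positions in a quadruple. -/
def markF : Formula := Formula.and (dia loopF) (Formula.and (neg (dia numF)) (neg loopF))

/-- The formula describing the number denoted by a term; a variable denotes the `R`-minimal number
satisfying a propositional variable. -/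
def Term.toFormula : Term → Formula
  | var i => Formula.and (Formula.var i) (minimal numF (Formula.var i))
  | zero => minimal numF numF
  | succ t => next numF t.toFormula

/-- The formula describing the `i`-th coordinate point with value `φ`. -/
def coordF (i : ℕ) (φ : Formula) : Formula :=
  Formula.and (Formula.and (dia φ) (neg (dia (dia φ))))
    (Formula.and (dia (rung markF i)) (neg (dia (rung markF (i + 1)))))

/-- The formula describing the quadruple with the given components. -/
def tupleF (a : Atom Formula) : Formula :=
  Formula.and (Formula.and (dia (coordF 0 a.fst)) (dia (coordF 1 a.snd)))
    (Formula.and (dia (coordF 2 a.thd)) (dia (coordF 3 a.fth)))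

/-- The formula saying that an atom holds. -/
def Atom.toFormula (a : Atom Term) : Formula := ex (tupleF (a.map Term.toFormula))

/-- The formula saying that a Horn clause holds. -/
def Clause.toFormula (c : Clause) : Formula :=
  imp (conj (c.prem.map Atom.toFormula)) c.concl.toFormula

/-- The formula which is unifiable if and only if `q` is derivable by the program `P`. -/
def goalFormula (P : List Clause) (q : Atom ℕ) : Formula :=
  imp (conj (P.map Clause.toFormula)) q.quote.toFormula

/-! ### The encoding in arbitrary Kripke models -/

section Semantics

variable {W : Type} {R : W → W → Prop} {V V' : ℕ → W → Prop}

@[simp] theorem sat_top (x : W) : Sat R V top x := by simp [top]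

@[simp] theorem sat_dia (φ : Formula) (x : W) :
    Sat R V (dia φ) x ↔ ∃ y, R x y ∧ Sat R V φ y := by
  simp [dia]

@[simp] theorem sat_conj (l : List Formula) (x : W) :
    Sat R V (conj l) x ↔ ∀ φ ∈ l, Sat R V φ x := by
  induction l with
  | nil => simp [conj]
  | cons φ l ih => simp [conj, ih]

/-- The only variable involved is the one inside `top`, where its value does not matter. The same
holds for marks and numerals. -/
theorem sat_numF_congr (x : W) : Sat R V numF x ↔ Sat R V' numF x := by
  simp [numF, loopF]

theorem sat_markF_congr (x : W) : Sat R V markF x ↔ Sat R V' markF x := by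
  simp [markF, loopF, numF]

theorem sat_rung_markF_congr (n : ℕ) (x : W) :
    Sat R V (rung markF n) x ↔ Sat R V' (rung markF n) x := by
  induction n generalizing x with
  | zero => simp [rung, minimal, sat_markF_congr (V := V) (V' := V')]
  | succ n ih => simp [rung, next, sat_markF_congr (V := V) (V' := V'), ih]

theorem sat_num_congr (n : ℕ) (x : W) :
    Sat R V (Term.num n).toFormula x ↔ Sat R V' (Term.num n).toFormula x := by
  induction n generalizing x with
  | zero => simp [Term.add, Term.toFormula, minimal, sat_numF_congr (V := V) (V' := V')]
  | succ n ih =>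
    simp only [Term.add, Term.toFormula, next, sat_and, sat_dia, sat_neg] at ih ⊢
    simp only [ih, sat_numF_congr (V := V) (V' := V')]

theorem sat_coordF_congr (i : ℕ) {φ ψ : Formula} (h : ∀ x, Sat R V φ x ↔ Sat R V' ψ x) (x : W) :
    Sat R V (coordF i φ) x ↔ Sat R V' (coordF i ψ) x := by
  simp only [coordF, sat_and, sat_dia, sat_neg, h, sat_rung_markF_congr (V := V) (V' := V')]

/-- The leading ∃ makes the truth of an atom independent of the point, so `x` and `y` may differ. -/
theorem sat_atom_congr {a b : Atom Term} (h₁ : ∀ x, Sat R V a.fst.toFormula x ↔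
      Sat R V' b.fst.toFormula x)
    (h₂ : ∀ x, Sat R V a.snd.toFormula x ↔ Sat R V' b.snd.toFormula x)
    (h₃ : ∀ x, Sat R V a.thd.toFormula x ↔ Sat R V' b.thd.toFormula x)
    (h₄ : ∀ x, Sat R V a.fth.toFormula x ↔ Sat R V' b.fth.toFormula x) (x y : W) :
    Sat R V a.toFormula x ↔ Sat R V' b.toFormula y := by
  simp only [Atom.toFormula, tupleF, Atom.map, sat_ex, sat_and, sat_dia, sat_coordF_congr _ h₁,
    sat_coordF_congr _ h₂, sat_coordF_congr _ h₃, sat_coordF_congr _ h₄]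

theorem sat_quote_congr (q : Atom ℕ) (x y : W) :
    Sat R V q.quote.toFormula x ↔ Sat R V' q.quote.toFormula y :=
  sat_atom_congr (sat_num_congr _) (sat_num_congr _) (sat_num_congr _) (sat_num_congr _) x y

/-- No number is `R`-related to itself. -/
theorem not_dia_num (n : ℕ) (x : W) (h : Sat R V (Term.num n).toFormula x) :
    Sat R V numF x ∧ ¬ Sat R V (dia (Term.num n).toFormula) x := by
  cases n with
  | zero =>
    simp only [Term.add, Term.toFormula, minimal, sat_and, sat_neg, sat_dia] at h ⊢
    exact ⟨h.1, fun ⟨y, hy, h'⟩ => h.2 ⟨y, hy, h'.1, h'.1⟩⟩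
  | succ n =>
    simp only [Term.add, Term.toFormula, next, sat_and, sat_neg, sat_dia] at h ⊢
    exact ⟨h.1, fun ⟨y, hy, h'⟩ => h.2.2 ⟨y, hy, h'.2.1⟩⟩

/-- If the propositional variables are interpreted by numerals, then terms are interpreted by the
numerals of their values. -/
theorem sat_term_iff_num {v : ℕ → ℕ}
    (hV : ∀ i x, V i x ↔ Sat R V' (Term.num (v i)).toFormula x) (t : Term) (x : W) :
    Sat R V t.toFormula x ↔ Sat R V' (Term.num (t.eval v)).toFormula x := by
  induction t generalizing x with
  | var i =>
    simp only [Term.toFormula, Term.eval, minimal, sat_and, sat_neg, sat_dia, sat_var, hV,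
      sat_numF_congr (V := V) (V' := V')]
    -- Minimality costs nothing here: a point satisfying a numeral never sees another point
    -- satisfying it, even in a non-transitive model.
    refine ⟨fun h => h.1, fun h => ⟨h, ?_⟩⟩
    have := not_dia_num _ x h
    rw [sat_dia] at this
    exact ⟨this.1, fun ⟨y, hy, h'⟩ => this.2 ⟨y, hy, h'.2⟩⟩
  | zero => exact sat_num_congr 0 x
  | succ t ih =>
    simp only [Term.toFormula, Term.eval, Term.add, next, sat_and, sat_dia, sat_neg, ih,
      sat_numF_congr (V := V) (V' := V')]

theorem sat_atom_iff_quote {v : ℕ → ℕ}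
    (hV : ∀ i x, V i x ↔ Sat R V' (Term.num (v i)).toFormula x) (a : Atom Term) (x y : W) :
    Sat R V a.toFormula x ↔ Sat R V' (a.eval v).quote.toFormula y :=
  sat_atom_congr (sat_term_iff_num hV _) (sat_term_iff_num hV _) (sat_term_iff_num hV _)
    (sat_term_iff_num hV _) x y

theorem sat_clause (c : Clause) (x : W) : Sat R V c.toFormula x ↔
    ((∀ a ∈ c.prem, Sat R V a.toFormula x) → Sat R V c.concl.toFormula x) := by
  simp [Clause.toFormula]

theorem sat_clause_iff_closed {v : ℕ → ℕ}
    (hV : ∀ i x, V i x ↔ Sat R V' (Term.num (v i)).toFormula x) (c : Clause) (x y : W) :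
    Sat R V c.toFormula x ↔ c.Closed v {q | Sat R V' q.quote.toFormula y} := by
  simp only [sat_clause, Clause.Closed, Set.mem_ofPred_eq, sat_atom_iff_quote hV _ x y]

end Semantics

/-! ## Derivable goals are unifiable -/

/-- The substitution of numerals for variables. -/
def numSubst (v : ℕ → ℕ) (i : ℕ) : Formula := (Term.num (v i)).toFormula

/-- The substitution that agrees with `numSubst v` for the first clause instance `(c, v)` in the
list that fails. -/
def selector : List (Clause × (ℕ → ℕ)) → ℕ → Formula
  | [] => var
  | (c, v) :: l => fun i =>
    Formula.and (imp (c.toFormula.subst (numSubst v)) (selector l i))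
      (imp (neg (c.toFormula.subst (numSubst v))) (numSubst v i))

section Unifiers

variable {W : Type} {R : W → W → Prop} {V : ℕ → W → Prop}

/-- If the head instance holds, the selector acts as that of the tail and induction applies. If it
fails, the selector acts as `numSubst v` and makes that very clause false, against the assumption.
-/
theorem closed_of_sat_selector (l : List (Clause × (ℕ → ℕ))) (x : W)
    (h : ∀ z ∈ l, Sat R V (z.1.toFormula.subst (selector l)) x) :
    ∀ z ∈ l, z.1.Closed z.2 {q | Sat R V q.quote.toFormula x} := by
  induction l with
  | nil => simp
  | cons z l ih =>
    obtain ⟨c, v⟩ := z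
    have hc (y : W) : Sat R V (c.toFormula.subst (numSubst v)) y ↔
        c.Closed v {q | Sat R V q.quote.toFormula x} :=
      (sat_subst _ _ y).trans (sat_clause_iff_closed (fun _ _ => Iff.rfl) c y x)
    by_cases hcl : c.Closed v {q | Sat R V q.quote.toFormula x}
    · have hs : (fun i y => Sat R V (selector ((c, v) :: l) i) y) =
          fun i y => Sat R V (selector l i) y := by
        funext i y
        simp [selector, hc, hcl]
      rw [List.forall_mem_cons] at h ⊢
      refine ⟨hcl, ih fun z hz => ?_⟩
      have := h.2 z hz
      rwa [sat_subst, hs, ← sat_subst] at this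
    · have hs : (fun i y => Sat R V (selector ((c, v) :: l) i) y) =
          fun i y => Sat R V (numSubst v i) y := by
        funext i y
        simp [selector, hc, hcl]
      have := h _ List.mem_cons_self
      rw [sat_subst, hs, ← sat_subst] at this
      exact absurd ((hc x).1 this) hcl

theorem exists_subst_mem_of_derivable {L : Set Formula} (hL : IsNormalLogic L) {P : List Clause}
    {q : Atom ℕ} (h : Derivable P q) : ∃ σ : ℕ → Formula, (goalFormula P q).subst σ ∈ L := by
  obtain ⟨l, hl, hq⟩ := h.exists_instances
  refine ⟨selector l, hL.mem_of_forall_sat fun W R V x => ?_⟩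
  rw [sat_subst, goalFormula, sat_imp, sat_conj]
  intro hP
  -- The derivation is replayed in the set of ground atoms true in the model.
  have := hq {q | Sat R V q.quote.toFormula x} (closed_of_sat_selector l x fun z hz => ?_)
  · exact (sat_quote_congr q x x).1 this
  · rw [sat_subst]
    exact hP _ (List.mem_map_of_mem (hl z hz))

end Unifiers

/-! ## Unifiable goals are derivable -/

/-- The points of the transitive frame associated with a set `S` of quadruples. -/
inductive World (S : Set (Atom ℕ)) : Type
  | dead : World S
  | loop : World S
  | mark (i : ℕ) : World S
  | num (k : ℕ) : World S
  | coord (i k : ℕ) : World S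
  | tuple (q : Atom ℕ) (hq : q ∈ S) : World S

namespace World

variable {S : Set (Atom ℕ)}

/-- The accessibility relation of the frame associated with a set of quadruples. -/
def Rel : World S → World S → Prop
  | dead, _ => False
  | loop, loop => True
  | loop, _ => False
  | mark _, dead => True
  | mark _, loop => True
  | mark i, mark j => j < i
  | mark _, _ => False
  | num _, dead => True
  | num k, num l => l < k
  | num _, _ => False
  | coord _ _, dead => True
  | coord _ _, loop => True
  | coord i _, mark j => j ≤ i
  | coord _ k, num l => l ≤ k
  | coord _ _, _ => False
  | tuple _ _, tuple _ _ => False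
  | tuple q _, coord i k => i = 0 ∧ k = q.fst ∨ i = 1 ∧ k = q.snd ∨ i = 2 ∧ k = q.thd ∨
      i = 3 ∧ k = q.fth
  | tuple _ _, _ => True

theorem rel_trans (x y z : World S) (h : Rel x y) (h' : Rel y z) : Rel x z := by
  cases x <;> cases y <;> cases z <;> simp only [Rel] at * <;> omega

theorem exists_iff {p : World S → Prop} : (∃ x, p x) ↔ p dead ∨ p loop ∨ (∃ i, p (mark i)) ∨
    (∃ k, p (num k)) ∨ (∃ i k, p (coord i k)) ∨ ∃ q hq, p (tuple q hq) := by
  constructor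
  · rintro ⟨x, hx⟩
    cases x with
    | dead => exact Or.inl hx
    | loop => exact Or.inr (Or.inl hx)
    | mark i => exact Or.inr (Or.inr (Or.inl ⟨i, hx⟩))
    | num k => exact Or.inr (Or.inr (Or.inr (Or.inl ⟨k, hx⟩)))
    | coord i k => exact Or.inr (Or.inr (Or.inr (Or.inr (Or.inl ⟨i, k, hx⟩))))
    | tuple q hq => exact Or.inr (Or.inr (Or.inr (Or.inr (Or.inr ⟨q, hq, hx⟩))))
  · rintro (h | h | ⟨_, h⟩ | ⟨_, h⟩ | ⟨_, _, h⟩ | ⟨_, _, h⟩) <;> exact ⟨_, h⟩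

/-! ### Truth of the encoding formulas in the frame -/

variable {V : ℕ → World S → Prop}

theorem sat_dia_top (x : World S) : Sat Rel V (dia top) x ↔ x ≠ dead := by
  cases x <;> simp [exists_iff, Rel]

theorem sat_loopF (x : World S) : Sat Rel V loopF x ↔ x = loop := by
  rw [loopF, sat_and, sat_box]
  simp only [sat_dia_top]
  cases x with
  | dead => simp
  | loop =>
    refine iff_of_true ⟨by simp, fun y hy => ?_⟩ rfl
    rintro rfl
    exact hy
  | _ => exact iff_of_false (fun h => h.2 dead trivial rfl) (by simp)

/-- Marks, coordinates and tuples all see the reflexive end point; numbers do not. -/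
theorem sat_numF (x : World S) : Sat Rel V numF x ↔ ∃ k, x = num k := by
  rw [numF, sat_and, sat_dia_top, sat_and, sat_neg, sat_neg, sat_dia]
  simp only [sat_loopF, exists_eq_right]
  cases x <;> simp [Rel]

theorem sat_markF (x : World S) : Sat Rel V markF x ↔ ∃ i, x = mark i := by
  rw [markF, sat_and, sat_and, sat_neg, sat_neg, sat_dia, sat_dia]
  simp only [sat_loopF, sat_numF, exists_eq_right]
  cases x with
  | coord i k => exact iff_of_false (fun h => h.2.1 ⟨num 0, Nat.zero_le k, 0, rfl⟩) (by simp)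
  | tuple q hq => exact iff_of_false (fun h => h.2.1 ⟨num 0, trivial, 0, rfl⟩) (by simp)
  | _ => simp [Rel]

theorem sat_rung_markF (n : ℕ) (x : World S) : Sat Rel V (rung markF n) x ↔ x = mark n := by
  induction n generalizing x with
  | zero =>
    simp only [rung, minimal, sat_and, sat_neg, sat_dia, sat_markF]
    cases x <;> simp [Rel]
    exact ⟨fun h => Nat.le_zero.1 (h 0), fun h x => h ▸ Nat.zero_le x⟩
  | succ n ih =>
    simp only [rung, next, sat_and, sat_neg, sat_dia, sat_markF, ih]
    cases x <;> simp [exists_iff, Rel]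
    refine ⟨fun h => ?_, fun h => ⟨by omega, fun x hx => by omega⟩⟩
    by_contra hne
    -- Beyond `n + 1`, the mark `n + 1` would lie strictly between the point and the mark `n`.
    have := h.2 (n + 1) (by omega)
    omega

/-- A coordinate is recognised by the largest number and the largest mark it sees. Tuples are
excluded because they reach `num n` in two steps, through `num (n + 1)`. -/
theorem sat_coordF {n : ℕ} {φ : Formula} (h : ∀ x, Sat Rel V φ x ↔ x = num n) (i : ℕ)
    (x : World S) : Sat Rel V (coordF i φ) x ↔ x = coord i n := by
  simp only [coordF, sat_and, sat_neg, sat_dia, sat_rung_markF, h]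
  cases x <;> simp [exists_iff, Rel]
  refine ⟨fun h => ⟨le_antisymm h.2.2 h.2.1, le_antisymm (h.1.2 _ le_rfl) h.1.1⟩, ?_⟩
  rintro ⟨rfl, rfl⟩
  simp

theorem not_sat_coordF {φ : Formula} (h : ∀ x, ¬ Sat Rel V φ x) (i : ℕ)
    (x : World S) : ¬ Sat Rel V (coordF i φ) x := by
  simp [coordF, h]

open Classical in
/-- The least number satisfying a propositional variable. -/
noncomputable def least (V : ℕ → World S → Prop) (i : ℕ) : ℕ :=
  if h : ∃ k, V i (num k) then Nat.find h else 0

-- Well-ordering of ℕ provides the denotation of a variable. With no candidate the formula holds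
-- nowhere, so the default 0 in `least` is harmless.
open Classical in
theorem sat_term (t : Term) (x : World S) : Sat Rel V t.toFormula x ↔
    (∀ i ∈ t.vars, ∃ k, V i (num k)) ∧ x = num (t.eval (least V)) := by
  induction t generalizing x with
  | var i =>
    simp only [Term.toFormula, Term.vars, Term.eval, minimal, sat_and, sat_neg, sat_dia, sat_var,
      sat_numF, List.mem_singleton, forall_eq]
    by_cases hd : ∃ k, V i (num k)
    · have hmin {m : ℕ} : V i (num m) → least V i ≤ m := fun hm => by
        rw [least, dif_pos hd]
        exact Nat.find_min' hd hm
      have hspec : V i (num (least V i)) := by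
        rw [least, dif_pos hd]
        exact Nat.find_spec hd
      simp only [hd, true_and]
      constructor
      · rintro ⟨hV, ⟨k, rfl⟩, hn⟩
        exact congrArg num (le_antisymm
          (not_lt.1 fun hlt => hn ⟨num _, hlt, ⟨_, rfl⟩, hspec⟩) (hmin hV))
      · rintro rfl
        refine ⟨hspec, ⟨_, rfl⟩, ?_⟩
        rintro ⟨y, hy, ⟨k, rfl⟩, hV⟩
        exact absurd (hmin hV) (not_le.2 hy)
    · refine iff_of_false ?_ fun h => hd h.1
      rintro ⟨hV, ⟨k, rfl⟩, -⟩
      exact hd ⟨k, hV⟩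
  | zero =>
    simp only [Term.toFormula, Term.vars, Term.eval, minimal, sat_and, sat_neg, sat_dia, sat_numF]
    cases x <;> simp [Rel]
    exact ⟨fun h => Nat.le_zero.1 (h 0), fun h x => h ▸ Nat.zero_le x⟩
  | succ t ih =>
    simp only [Term.toFormula, Term.vars, Term.eval, next, sat_and, sat_neg, sat_dia, sat_numF, ih]
    by_cases hd : ∀ i ∈ t.vars, ∃ k, V i (num k)
    · simp only [and_iff_right hd]
      cases x <;> simp [exists_iff, Rel]
      refine ⟨fun h => ?_, fun h => ⟨by omega, fun x hx => by omega⟩⟩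
      by_contra hne
      have := h.2 (t.eval (least V) + 1) (by omega)
      omega
    · simp only [hd, false_and, and_false, exists_false]

theorem sat_coordF_term (t : Term) (i : ℕ) (x : World S) :
    Sat Rel V (coordF i t.toFormula) x ↔
      (∀ i ∈ t.vars, ∃ k, V i (num k)) ∧ x = coord i (t.eval (least V)) := by
  by_cases hd : ∀ i ∈ t.vars, ∃ k, V i (num k)
  · rw [and_iff_right hd]
    exact sat_coordF (fun y => by rw [sat_term, and_iff_right hd]) i x
  · exact iff_of_false (not_sat_coordF (fun y => by rw [sat_term]; exact fun h => hd h.1) i x)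
      fun h => hd h.1

theorem sat_atom (a : Atom Term) (x : World S) : Sat Rel V a.toFormula x ↔
    (∀ i ∈ a.vars, ∃ k, V i (num k)) ∧ a.eval (least V) ∈ S := by
  simp only [Atom.toFormula, tupleF, Atom.map, sat_ex, sat_and, sat_dia, sat_coordF_term,
    Atom.vars, List.mem_append]
  constructor
  · rintro ⟨y, ⟨⟨_, h₀, d₀, rfl⟩, ⟨_, h₁, d₁, rfl⟩⟩, ⟨_, h₂, d₂, rfl⟩, ⟨_, h₃, d₃, rfl⟩⟩
    cases y with
    | tuple q hq =>
      simp only [Rel] at h₀ h₁ h₂ h₃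
      refine ⟨?_, ?_⟩
      · rintro i (((hi | hi) | hi) | hi)
        exacts [d₀ i hi, d₁ i hi, d₂ i hi, d₃ i hi]
      · convert hq using 1
        obtain ⟨q₀, q₁, q₂, q₃⟩ := q
        rw [Atom.mk.injEq]
        exact ⟨by simpa using h₀, by simpa using h₁, by simpa using h₂, by simpa using h₃⟩
    | _ => exact h₀.elim
  · rintro ⟨hd, hq⟩
    exact ⟨tuple _ hq,
      ⟨⟨coord 0 _, Or.inl ⟨rfl, rfl⟩, fun i hi => hd i (by simp [hi]), rfl⟩,
        ⟨coord 1 _, Or.inr (Or.inl ⟨rfl, rfl⟩), fun i hi => hd i (by simp [hi]), rfl⟩⟩,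
      ⟨coord 2 _, Or.inr (Or.inr (Or.inl ⟨rfl, rfl⟩)), fun i hi => hd i (by simp [hi]), rfl⟩,
      ⟨coord 3 _, Or.inr (Or.inr (Or.inr ⟨rfl, rfl⟩)), fun i hi => hd i (by simp [hi]), rfl⟩⟩

/-- True premises provide a denotation for each of their variables, hence by safety for those of the
conclusion; otherwise an undefined variable could make the conclusion false. -/
theorem sat_safe_clause {c : Clause} (hc : c.Safe) (hS : c.Closed (least V) S) (x : World S) :
    Sat Rel V c.toFormula x := by
  rw [sat_clause]
  simp only [sat_atom]
  refine fun h => ⟨fun i hi => ?_, hS fun a ha => (h a ha).2⟩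
  obtain ⟨a, ha, hia⟩ := hc i hi
  exact (h a ha).1 i hia

end World

theorem derivable_of_subst_mem {L : Set Formula} (hL : L ⊆ K4u) {P : List Clause}
    (hP : ∀ c ∈ P, c.Safe) {q : Atom ℕ} {σ : ℕ → Formula}
    (h : (goalFormula P q).subst σ ∈ L) : Derivable P q := by
  -- The valuation is arbitrary: the one that matters is induced from it by `σ`, and clauses hold
  -- under all valuations.
  have := sat_of_mem_K4u (World.rel_trans (S := {q | Derivable P q})) (hL h) (fun _ _ => True)
    World.dead
  rw [sat_subst, goalFormula, sat_imp, sat_conj, World.sat_atom] at this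
  have := (this ?_).2
  · simpa [Atom.map, Term.eval_num] using this
  · simp only [List.mem_map]
    rintro _ ⟨c, hc, rfl⟩
    exact World.sat_safe_clause (hP c hc) (fun h => Derivable.step c hc _ h) _


/-! ## Computability of the reduction -/

section Computability

variable {α : Type} [Primcodable α]

theorem primrec_of_toNat {f : α → Formula} (h : Primrec fun a => (f a).toNat) : Primrec f :=
  Primrec.encode_iff.1 h

theorem Primrec.toNat {f : α → Formula} (h : Primrec f) : Primrec fun a => (f a).toNat :=
  Primrec.encode_iff.2 h

theorem primrec_neg {f : α → Formula} (h : Primrec f) : Primrec fun a => neg (f a) :=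
  primrec_of_toNat (Primrec.nat_add.comp (Primrec.nat_mul.comp (Primrec.const 5) (Primrec.toNat h))
    (Primrec.const 1))

theorem primrec_and {f g : α → Formula} (hf : Primrec f) (hg : Primrec g) :
    Primrec fun a => Formula.and (f a) (g a) :=
  primrec_of_toNat (Primrec.nat_add.comp (Primrec.nat_mul.comp (Primrec.const 5)
    (Primrec₂.natPair.comp (Primrec.toNat hf) (Primrec.toNat hg))) (Primrec.const 2))

theorem primrec_box {f : α → Formula} (h : Primrec f) : Primrec fun a => box (f a) :=
  primrec_of_toNat (Primrec.nat_add.comp (Primrec.nat_mul.comp (Primrec.const 5) (Primrec.toNat h))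
    (Primrec.const 3))

theorem primrec_univ {f : α → Formula} (h : Primrec f) : Primrec fun a => univ (f a) :=
  primrec_of_toNat (Primrec.nat_add.comp (Primrec.nat_mul.comp (Primrec.const 5) (Primrec.toNat h))
    (Primrec.const 4))

theorem primrec_dia {f : α → Formula} (h : Primrec f) : Primrec fun a => dia (f a) :=
  primrec_neg (primrec_box (primrec_neg h))

theorem primrec_ex {f : α → Formula} (h : Primrec f) : Primrec fun a => ex (f a) :=
  primrec_neg (primrec_univ (primrec_neg h))

theorem primrec_imp {f g : α → Formula} (hf : Primrec f) (hg : Primrec g) :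
    Primrec fun a => imp (f a) (g a) :=
  primrec_neg (primrec_and hf (primrec_neg hg))

theorem primrec_next {κ : Formula} {f : α → Formula} (h : Primrec f) :
    Primrec fun a => next κ (f a) :=
  primrec_and (Primrec.const κ) (primrec_and (primrec_dia h) (primrec_neg (primrec_dia
    (primrec_dia h))))

theorem primrec_num : Primrec fun n => (Term.num n).toFormula := by
  refine (Primrec.nat_rec₁ (minimal numF numF)
    (primrec_next (κ := numF) (Primrec.snd (α := ℕ))).to₂).of_eq fun n => ?_
  induction n with
  | zero => rfl
  | succ n ih => exact congrArg (next numF) ih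

theorem primrec_coordF (i : ℕ) {f : α → Formula} (h : Primrec f) :
    Primrec fun a => coordF i (f a) :=
  primrec_and (primrec_and (primrec_dia h) (primrec_neg (primrec_dia (primrec_dia h))))
    (Primrec.const _)

theorem primrec_tupleF {f₀ f₁ f₂ f₃ : α → Formula} (h₀ : Primrec f₀) (h₁ : Primrec f₁)
    (h₂ : Primrec f₂) (h₃ : Primrec f₃) :
    Primrec fun a => tupleF ⟨f₀ a, f₁ a, f₂ a, f₃ a⟩ :=
  primrec_and
    (primrec_and (primrec_dia (primrec_coordF 0 h₀)) (primrec_dia (primrec_coordF 1 h₁)))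
    (primrec_and (primrec_dia (primrec_coordF 2 h₂)) (primrec_dia (primrec_coordF 3 h₃)))

/-- The program is fixed, so only the numeral in the second slot varies with `n`. -/
theorem primrec_goalFormula (P : List Clause) :
    Primrec fun n => goalFormula P (haltAtom id n) :=
  primrec_imp (Primrec.const _) (primrec_ex (primrec_tupleF (Primrec.const _) primrec_num
    (Primrec.const _) (Primrec.const _)))

end Computability

/-- The formula `φ` is unifiable in `L` if and only if the rule `φ / ⊥` is not admissible. -/
theorem admissible_neg_top_iff {L : Set Formula} (hK4u : L ⊆ K4u) (φ : Formula) :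
    Admissible L ([φ], neg top) ↔ ¬ ∃ σ : ℕ → Formula, φ.subst σ ∈ L := by
  simp only [Admissible, List.mem_singleton, forall_eq, not_exists]
  refine forall_congr' fun σ => imp_congr_right fun _ => iff_of_false (fun h => ?_) id
  -- A single reflexive point shows that no instance of ⊥ belongs to `L`.
  have := sat_of_mem_K4u (R := fun _ _ : Unit => True) (fun _ _ _ _ _ => trivial) (hK4u h)
    (fun _ _ => True) ()
  rw [sat_subst, sat_neg] at this
  exact this (sat_top ())

/-- A code halts on input `0` if and only if the corresponding goal formula is unifiable. -/
theorem exists_unifier_iff {L : Set Formula} (hL : IsNormalLogic L) (hK4u : L ⊆ K4u)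
    (c : Nat.Partrec.Code) :
    (∃ σ : ℕ → Formula,
      (goalFormula program (haltAtom id (Encodable.encode c))).subst σ ∈ L) ↔ (c.eval 0).Dom :=
  ⟨fun ⟨_, h⟩ => (derivable_halt_iff c).1 (derivable_of_subst_mem hK4u program_safe h),
    fun h => exists_subst_mem_of_derivable hL ((derivable_halt_iff c).2 h)⟩

end ModalU

theorem theorem2 (L : Set ModalU.Formula) (hL : ModalU.IsNormalLogic L)
    (hKu : ModalU.Ku ⊆ L) (hK4u : L ⊆ ModalU.K4u) :
    ¬ ComputablePred (fun r : ModalU.InferenceRule => ModalU.Admissible L r) := by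
  intro h
  obtain ⟨f, hf, hfL⟩ := ComputablePred.computable_iff.1 h
  have hr : Primrec fun c : Nat.Partrec.Code =>
      (([ModalU.goalFormula ModalU.program (ModalU.haltAtom id (Encodable.encode c))],
        ModalU.Formula.neg ModalU.top) : ModalU.InferenceRule) :=
    .pair (Primrec.list_cons.comp ((ModalU.primrec_goalFormula _).comp Primrec.encode)
      (Primrec.const [])) (Primrec.const _)
  -- The complement is taken because halting corresponds to non-admissibility of the rule with
  -- conclusion ⊥.
  refine ComputablePred.halting_problem 0 (ComputablePred.of_eq
    (ComputablePred.computable_iff.2 ⟨_, hf.comp hr.to_comp, rfl⟩).not fun c => ?_)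
  rw [← congrFun hfL, ModalU.admissible_neg_top_iff hK4u, not_not,
    ModalU.exists_unifier_iff hL hK4u]
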